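/- Let $M$ be a closed topological $3$-manifold with a triangulation $T$ (a finite simplicial complex whose geometric realization is homeomorphic to $M$), with vertex set $V$, edge set $E$, and set $E_+$ of directed edges $(i,j)$. A length function $\ell:E\to\mathbb{R}$ makes $T$ piecewise flat if every simplex of $T$ embeds in Euclidean space as a nondegenerate Euclidean simplex with edge lengths given by $\ell$. Let $\mathfrak{met}(M,T)$ be the set of $d\in\mathbb{R}^{E_+}$ such that $\ell_{ij}(d)=d_{ij}+d_{ji}$ makes $T$ piecewise flat and $d_{ij}^2+d_{jk}^2+d_{ki}^2=d_{ji}^2+d_{ik}^2+d_{kj}^2$ for every triangle $\{i,j,k\}$ of $T$. A conformal structure on an open set $U\subset\mathbb{R}^V$ is a smooth map $f\mapsto d(f)$ from $U$ to $\mathfrak{met}(M,T)$ such that, for every $(i,j)\in E_+$, $$\frac{\partial \ell_{ij}}{\partial f_i}=d_{ij},\qquad \frac{\partial d_{ij}}{\partial f_k}=0\quad\text{for all } k\in V\setminus\{i,j\}.$$ Let $\beta_{ij,k\ell}$ be the dihedral angle at the edge $\{i,j\}$ of the tetrahedron $\{i,j,k,\ell\}$, let $V_{ijk\ell}$ be its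 volume, and let $A_{ijk}$ be the area of the triangle $\{i,j,k\}$. Put $$\mathcal{EHR}=\sum_{\{i,j\}\in E}\Bigl(2\pi-\sum_{k,\ell}\beta_{ij,k\ell}\Bigr)\ell_{ij},\qquad \mathcal{V}=\sum_{\{i,j,k,\ell\}}V_{ijk\ell},\qquad K_i=\sum_{j:\{i,j\}\in E}\Bigl(2\pi-\sum_{k,\ell}\beta_{ij,k\ell}\Bigr)d_{ij},$$ where the sums over $k,\ell$ are over all tetrahedra $\{i,j,k,\ell\}$ of $T$ containing the edge $\{i,j\}$ and the sum in $\mathcal{V}$ is over all tetrahedra of $T$. For $d\in\mathfrak{met}(M,T)$, each tetrahedron, embedded in $\mathbb{R}^3$ with vertices $v_i,v_j,v_k,v_\ell$, has a unique center: the point whose orthogonal projection to the line through any two vertices $v_a,v_b$ is the point of that line at signed distance $d_{ab}$ from $v_a$ (measured towards $v_b$). Let $h_{ijk,\ell}$ be the signed distance from the plane $v_iv_jv_k$ to this center, positive if the center is on the same side of the plane as the tetrahedron, and put $$V_i=\frac13\sum_{j,k,\ell}h_{ijk,\ell}A_{ijk},$$ where the sum is over all tetrahedra of $T$ containing $i$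 and, for each of them, over its three faces $\{i,j,k\}$ containing $i$, $\ell$ being the remaining vertex. Then for every conformal structure on $(M,T)$ with domain $U$, at every $f\in U$ and for every vertex $i\in V$, the following partial derivatives exist and $$\frac{\partial}{\partial f_i}\mathcal{EHR}\bigl(M,T,\ell(f)\bigr)=K_i,\qquad \frac{\partial}{\partial f_i}\mathcal{V}\bigl(M,T,\ell(f)\bigr)=V_i.$$ -/

import Mathlib

open scoped ContDiff

noncomputable section

namespace PiecewiseFlat

/-- Euclidean three-space. -/
abbrev E3 : Type := EuclideanSpace ℝ (Fin 3)

variable {V : Type*} [Fintype V] [DecidableEq V]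

/-! ### Triangulations -/

/-- The geometric realization of a finite abstract simplicial complex, in barycentric coordinates:
points of the standard simplex on the vertex set whose support is contained in a face. -/
def geometricRealization (T : AbstractSimplicialComplex V) : Set (V → ℝ) :=
  {x | (∀ v, 0 ≤ x v) ∧ ∑ v, x v = 1 ∧ ∃ s ∈ T, ∀ v, v ∉ s → x v = 0}

/-- `i` and `j` are the two ends of an edge of `T`. -/
def Adj (T : AbstractSimplicialComplex V) (i j : V) : Prop :=
  i ≠ j ∧ ({i, j} : Finset V) ∈ T

/-- The set `E₊(T)` of directed edges of `T`. -/
abbrev DirEdge (T : AbstractSimplicialComplex V) : Type _ :=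
  {e : V × V // Adj T e.1 e.2}

instance (T : AbstractSimplicialComplex V) : Fintype (DirEdge T) := Fintype.ofFinite _

open Classical in
/-- The (undirected) edges of `T`, as two-element sets of vertices. -/
def edges (T : AbstractSimplicialComplex V) : Finset (Finset V) :=
  Finset.univ.filter fun e => e ∈ T ∧ e.card = 2

open Classical in
/-- The tetrahedra of `T`, as four-element sets of vertices. -/
def tetrahedra (T : AbstractSimplicialComplex V) : Finset (Finset V) :=
  Finset.univ.filter fun s => s ∈ T ∧ s.card = 4

/-! ### Edge lengths and Euclidean simplices

A length function is recorded as a map `ℓ : V → V → ℝ`; only its values at the ends of edges are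
ever used. -/

/-- `p` embeds the simplex `s` in Euclidean space as a nondegenerate Euclidean simplex with edge
lengths given by `ℓ`. -/
def IsEmbedding (ℓ : V → V → ℝ) (s : Finset V) (p : V → E3) : Prop :=
  AffineIndependent ℝ (fun a : {a // a ∈ s} => p a) ∧
    ∀ a ∈ s, ∀ b ∈ s, a ≠ b → dist (p a) (p b) = ℓ a b

/-- `ℓ` makes `T` piecewise flat: every simplex can be embedded in Euclidean space as a
nondegenerate Euclidean simplex with edge lengths determined by `ℓ`. -/
def IsPiecewiseFlat (T : AbstractSimplicialComplex V) (ℓ : V → V → ℝ) : Prop :=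
  ∀ s ∈ T, ∃ p : V → E3, IsEmbedding ℓ s p

/-- A Euclidean embedding of the simplex `s` with edge lengths `ℓ` (unique up to isometries of
Euclidean space; arbitrary if there is none). -/
def embed (ℓ : V → V → ℝ) (s : Finset V) : V → E3 :=
  Classical.epsilon (IsEmbedding ℓ s)

/-- The Cayley-Menger matrix of the simplex `s` with edge lengths `ℓ`. -/
def cayleyMenger (ℓ : V → V → ℝ) (s : Finset V) :
    Matrix (Option {a // a ∈ s}) (Option {a // a ∈ s}) ℝ
  | none, none => 0
  | none, some _ => 1
  | some _, none => 1
  | some a, some b => if a = b then 0 else ℓ a b ^ 2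

/-- The `n`-dimensional volume of the `n`-simplex `s` with edge lengths `ℓ`, by the Cayley-Menger
formula `vol² = (-1)ⁿ⁺¹ det / (2ⁿ (n!)²)`, where `n + 1` is the number of vertices:
length for `n = 1`, area for `n = 2`, volume for `n = 3`. -/
def simplexVolume (ℓ : V → V → ℝ) (s : Finset V) : ℝ :=
  Real.sqrt ((-1) ^ s.card * (cayleyMenger ℓ s).det /
    (2 ^ (s.card - 1) * ((s.card - 1).factorial : ℝ) ^ 2))

/-- The dihedral angle `β_{ij,kl}` at the edge `{i, j}` of the tetrahedron `s = {i, j, k, l}`: the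
angle between the components orthogonal to the edge of the vectors from `i` to `k` and to `l`. -/
def dihedralAngle (ℓ : V → V → ℝ) (s : Finset V) (i j k l : V) : ℝ :=
  let p := embed ℓ s
  let W := (Submodule.span ℝ {p j - p i})ᗮ
  InnerProductGeometry.angle (W.starProjection (p k - p i)) (W.starProjection (p l - p i))

/-! ### Curvature and the functionals -/

/-- The angle deficit `2π - ∑ β_{ij,kl}` at the edge `{i, j}`. The sum is over all tetrahedra
containing the edge; the factor `1 / 2` is there because `(k, l)` runs through both orderings of
the two remaining vertices of each of them. -/
def deficit (T : AbstractSimplicialComplex V) (ℓ : V → V → ℝ) (i j : V) : ℝ :=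
  2 * Real.pi - ∑ s ∈ (tetrahedra T).filter (fun s => i ∈ s ∧ j ∈ s),
    (1 / 2) * ∑ q ∈ (s \ {i, j}).offDiag, dihedralAngle ℓ s i j q.1 q.2

/-- The edge curvature `K_{ij}`. -/
def edgeCurvature (T : AbstractSimplicialComplex V) (ℓ : V → V → ℝ) (i j : V) : ℝ :=
  deficit T ℓ i j * ℓ i j

/-- The Einstein-Hilbert-Regge functional, the sum of `K_{ij}` over all edges `{i, j}` (each edge
has two orderings `(i, j)` of its ends, whence the factor `1 / 2`). -/
def EHR (T : AbstractSimplicialComplex V) (ℓ : V → V → ℝ) : ℝ :=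
  ∑ e ∈ edges T, (1 / 2) * ∑ q ∈ e.offDiag, edgeCurvature T ℓ q.1 q.2

/-- The total volume. -/
def totalVolume (T : AbstractSimplicialComplex V) (ℓ : V → V → ℝ) : ℝ :=
  ∑ s ∈ tetrahedra T, simplexVolume ℓ s

/-! ### Piecewise flat metrics -/

open Classical in
/-- The value `d_{ij}` of `d` at the directed edge `(i, j)` (zero if there is no such edge). -/
def dval {T : AbstractSimplicialComplex V} (d : DirEdge T → ℝ) (i j : V) : ℝ :=
  if h : Adj T i j then d ⟨(i, j), h⟩ else 0

/-- The edge lengths `ℓ_{ij} = d_{ij} + d_{ji}` determined by `d`. -/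
def len {T : AbstractSimplicialComplex V} (d : DirEdge T → ℝ) (i j : V) : ℝ :=
  dval d i j + dval d j i

/-- The space `𝔪𝔢𝔱(M, T)` of piecewise flat metrics on `T`. -/
def met (T : AbstractSimplicialComplex V) : Set (DirEdge T → ℝ) :=
  {d | IsPiecewiseFlat T (len d) ∧
    ∀ i j k, i ≠ j → j ≠ k → k ≠ i → ({i, j, k} : Finset V) ∈ T →
      dval d i j ^ 2 + dval d j k ^ 2 + dval d k i ^ 2 =
        dval d j i ^ 2 + dval d i k ^ 2 + dval d k j ^ 2}

/-- The scalar curvature `K_i`. -/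
def scalarCurvature {T : AbstractSimplicialComplex V} (d : DirEdge T → ℝ) (i : V) : ℝ :=
  open Classical in
  ∑ j ∈ Finset.univ.filter (fun j => Adj T i j), deficit T (len d) i j * dval d i j

/-- The center of the embedded simplex `s`: the point whose orthogonal projection to the line
through any two vertices `a`, `b` is the center of that edge, which has signed distance `d_{ab}`
from `a` and `d_{ba}` from `b`. For a tetrahedron and a metric `d` there is exactly one. -/
def center {T : AbstractSimplicialComplex V} (d : DirEdge T → ℝ) (s : Finset V) : E3 :=
  let p := embed (len d) s
  Classical.epsilon fun c : E3 => ∀ a ∈ s, ∀ b ∈ s, a ≠ b →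
    inner ℝ (c - AffineMap.lineMap (p a) (p b) (dval d a b / len d a b)) (p b - p a) = 0

/-- The signed distance `h` from the plane of the face `s \ {l}` of the tetrahedron `s` to the
center of `s`, positive if the center is on the same side of the plane as the tetrahedron. Here `i`
is any vertex of the face, and the unit normal is that of the component of `p l - p i` orthogonal
to the plane. -/
def centerHeight {T : AbstractSimplicialComplex V} (d : DirEdge T → ℝ) (s : Finset V)
    (i l : V) : ℝ :=
  let p := embed (len d) s
  signedDist ((vectorSpan ℝ (p '' (s.erase l : Finset V)))ᗮ.starProjection (p l - p i)) (p i)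
    (center d s)

/-- The vertex volume `V_i = (1/3) ∑ h_{ijk,l} A_{ijk}`: the sum is over all tetrahedra containing
`i` and over all faces containing `i` of these, the face being determined by the vertex `l ≠ i`
of the tetrahedron opposite to it. -/
def vertexVolume {T : AbstractSimplicialComplex V} (d : DirEdge T → ℝ) (i : V) : ℝ :=
  (1 / 3) * ∑ s ∈ (tetrahedra T).filter (fun s => i ∈ s), ∑ l ∈ s.erase i,
    centerHeight d s i l * simplexVolume (len d) (s.erase l)

/-! ### Conformal structures -/

/-- The partial derivative `∂F/∂f_k` exists at `f` and equals `a`. -/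
def HasPartialDerivAt (F : (V → ℝ) → ℝ) (k : V) (a : ℝ) (f : V → ℝ) : Prop :=
  HasDerivAt (fun t => F (Function.update f k t)) a (f k)

/-- `C` is (on `U`) a conformal structure on the triangulation `T` with domain `U`. -/
structure IsConformalStructure (T : AbstractSimplicialComplex V) (U : Set (V → ℝ))
    (C : (V → ℝ) → DirEdge T → ℝ) : Prop where
  isOpen : IsOpen U
  smooth : ContDiffOn ℝ ∞ C U
  mapsTo : Set.MapsTo C U (met T)
  partial_len : ∀ f ∈ U, ∀ i j, Adj T i j →
    HasPartialDerivAt (fun g => len (C g) i j) i (dval (C f) i j) f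
  partial_d : ∀ f ∈ U, ∀ i j, Adj T i j → ∀ k, k ≠ i → k ≠ j →
    HasPartialDerivAt (fun g => dval (C g) i j) k 0 f

end PiecewiseFlat

end

open scoped ContDiff

noncomputable section

namespace PiecewiseFlat

variable {V : Type*} [Fintype V] [DecidableEq V]

/-! ### Squared edge lengths, Gram entries and Gram determinants -/

/-! Varying only $f_i$ gives a one-parameter family of lengths in which each edge $\{i,j\}$ changes
at rate $d_{ij}$ and no edge missing $i$ changes to first order. Angles and volumes are rewritten by
Gram determinants as explicit functions of the lengths, and the problem is settled one tetrahedron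
at a time.

Curvature: by the product rule, the derivative of the sum of deficits times lengths has two parts.
The part that differentiates the angles vanishes on each tetrahedron (`schlaefli`); the other is
Regge's formula (`hasDerivAt_EHR`), which becomes $K_i$ once the rates $d_{ij}$ are inserted.
Schläfli's formula is itself algebra. Let $Q$ be the `areaSq` of a face, $F$ the `crossGram` of an
edge and $D$ the `gramDet`. Then $\sqrt D\,\ell\,d\beta = -(dF - F\,(dQ_1/2Q_1 + dQ_2/2Q_2))$, where
$Q_1, Q_2$ belong to the two faces at the edge. The three $F$ around a face add up to its $Q$, so
the sum over the six edges cancels.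

Volume: with $j,k,l$ fixed, the center $c$ satisfies $\langle c-p_i, p_a-p_i\rangle =
d_{ia}\ell_{ia}$, half the derivative of $\ell_{ia}^2$, so $p_i$ moves with velocity $p_i - c$. The
volume thus grows at the rate given by the tetrahedron minus the signed pyramid from $c$ over the
face opposite $i$, that is, by the three signed pyramids over the faces at $i$. Both sides are
expressed through `heightDet` (`hasDerivAt_gramDet`, `centerHeight_mul_simplexVolume`). -/

/-- The inner product of `p j - p i` and `p k - p i`, by the law of cosines. -/
def gram (ℓ : V → V → ℝ) (i j k : V) : ℝ :=
  (ℓ i j ^ 2 + ℓ i k ^ 2 - ℓ j k ^ 2) / 2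

/-- Four times the squared area of the triangle `{i, j, k}`. -/
def areaSq (ℓ : V → V → ℝ) (i j k : V) : ℝ :=
  ℓ i j ^ 2 * ℓ i k ^ 2 - gram ℓ i j k ^ 2

/-- The squared edge length at `{i, j}` times the inner product of the components orthogonal to
that edge of the vectors from `i` to `k` and to `l`. -/
def crossGram (ℓ : V → V → ℝ) (i j k l : V) : ℝ :=
  gram ℓ i k l * ℓ i j ^ 2 - gram ℓ i j k * gram ℓ i j l

/-- The Gram determinant of the tetrahedron `{i, j, k, l}`. -/
def gramDet (ℓ : V → V → ℝ) (i j k l : V) : ℝ :=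
  ℓ i j ^ 2 * ℓ i k ^ 2 * ℓ i l ^ 2 + 2 * gram ℓ i j k * gram ℓ i k l * gram ℓ i j l
    - ℓ i j ^ 2 * gram ℓ i k l ^ 2 - ℓ i k ^ 2 * gram ℓ i j l ^ 2 - ℓ i l ^ 2 * gram ℓ i j k ^ 2

/-- `i`, `j`, `k`, `l` are distinct and are the elements of `s`. -/
structure IsTetrahedron (s : Finset V) (i j k l : V) : Prop where
  ij : i ≠ j
  ik : i ≠ k
  il : i ≠ l
  jk : j ≠ k
  jl : j ≠ l
  kl : k ≠ l
  eq : s = {i, j, k, l}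

namespace IsTetrahedron

variable {s : Finset V} {i j k l : V}

omit [Fintype V] in
lemma swap_left (h : IsTetrahedron s i j k l) : IsTetrahedron s j i k l :=
  ⟨h.ij.symm, h.jk, h.jl, h.ik, h.il, h.kl, by rw [h.eq, Finset.insert_comm]⟩

omit [Fintype V] in
lemma swap_mid (h : IsTetrahedron s i j k l) : IsTetrahedron s i k j l :=
  ⟨h.ik, h.ij, h.il, h.jk.symm, h.kl, h.jl, by rw [h.eq, Finset.insert_comm j]⟩

omit [Fintype V] in
lemma swap_right (h : IsTetrahedron s i j k l) : IsTetrahedron s i j l k :=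
  ⟨h.ij, h.il, h.ik, h.jl, h.jk, h.kl.symm, by rw [h.eq, Finset.pair_comm k]⟩

omit [Fintype V] in
lemma mem_fst (h : IsTetrahedron s i j k l) : i ∈ s := by simp [h.eq]

omit [Fintype V] in
lemma mem_snd (h : IsTetrahedron s i j k l) : j ∈ s := by simp [h.eq]

omit [Fintype V] in
lemma mem_trd (h : IsTetrahedron s i j k l) : k ∈ s := by simp [h.eq]

omit [Fintype V] in
lemma mem_fth (h : IsTetrahedron s i j k l) : l ∈ s := by simp [h.eq]

end IsTetrahedron

omit [Fintype V] in
lemma exists_isTetrahedron_of_mem {s : Finset V} (hs : s.card = 4) {i : V} (hi : i ∈ s) :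
    ∃ j k l, IsTetrahedron s i j k l := by
  have : (s.erase i).card = 3 := by rw [Finset.card_erase_of_mem hi, hs]
  obtain ⟨j, k, l, h1, h2, h3, h4⟩ := Finset.card_eq_three.1 this
  have hm : ∀ a ∈ ({j, k, l} : Finset V), i ≠ a := fun a ha =>
    (Finset.ne_of_mem_erase (h4 ▸ ha)).symm
  exact ⟨j, k, l, hm j (by simp), hm k (by simp), hm l (by simp), h1, h2, h3,
    by rw [← h4, Finset.insert_erase hi]⟩

omit [Fintype V] in
lemma exists_isTetrahedron {s : Finset V} (hs : s.card = 4) :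
    ∃ i j k l, IsTetrahedron s i j k l := by
  obtain ⟨i, hi⟩ := Finset.card_pos.1 (by omega : 0 < s.card)
  exact ⟨i, exists_isTetrahedron_of_mem hs hi⟩

/-! ### Symmetries -/

omit [Fintype V] [DecidableEq V] in
lemma areaSq_swap_left {ℓ : V → V → ℝ} (hℓ : ∀ a b, ℓ a b = ℓ b a) (i j k : V) :
    areaSq ℓ j i k = areaSq ℓ i j k := by
  simp only [areaSq, gram, hℓ j i]; ring

omit [Fintype V] [DecidableEq V] in
lemma areaSq_swap_right {ℓ : V → V → ℝ} (hℓ : ∀ a b, ℓ a b = ℓ b a) (i j k : V) :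
    areaSq ℓ i k j = areaSq ℓ i j k := by
  simp only [areaSq, gram, hℓ k j]; ring

omit [Fintype V] [DecidableEq V] in
lemma crossGram_swap_left {ℓ : V → V → ℝ} (hℓ : ∀ a b, ℓ a b = ℓ b a) (i j k l : V) :
    crossGram ℓ j i k l = crossGram ℓ i j k l := by
  simp only [crossGram, gram, hℓ j i]; ring

omit [Fintype V] [DecidableEq V] in
lemma crossGram_swap_right {ℓ : V → V → ℝ} (hℓ : ∀ a b, ℓ a b = ℓ b a) (i j k l : V) :
    crossGram ℓ i j l k = crossGram ℓ i j k l := by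
  simp only [crossGram, gram, hℓ l k]; ring

omit [Fintype V] [DecidableEq V] in
lemma gramDet_swap_left {ℓ : V → V → ℝ} (hℓ : ∀ a b, ℓ a b = ℓ b a) (i j k l : V) :
    gramDet ℓ j i k l = gramDet ℓ i j k l := by
  simp only [gramDet, gram, hℓ j i]; ring

omit [Fintype V] [DecidableEq V] in
lemma gramDet_swap_mid {ℓ : V → V → ℝ} (hℓ : ∀ a b, ℓ a b = ℓ b a) (i j k l : V) :
    gramDet ℓ i k j l = gramDet ℓ i j k l := by
  simp only [gramDet, gram, hℓ k j]; ring

omit [Fintype V] [DecidableEq V] in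
lemma gramDet_swap_right {ℓ : V → V → ℝ} (hℓ : ∀ a b, ℓ a b = ℓ b a) (i j k l : V) :
    gramDet ℓ i j l k = gramDet ℓ i j k l := by
  simp only [gramDet, gram, hℓ l k]; ring

omit [Fintype V] [DecidableEq V] in
/-- The areas of three faces, projected to the plane of the fourth, add up to its area. -/
lemma crossGram_add_add {ℓ : V → V → ℝ} (hℓ : ∀ a b, ℓ a b = ℓ b a) (i j k l : V) :
    crossGram ℓ i j k l + crossGram ℓ i k j l + crossGram ℓ j k i l = areaSq ℓ i j k := by
  simp only [crossGram, areaSq, gram, hℓ k j, hℓ j i, hℓ k i]; ring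

omit [Fintype V] [DecidableEq V] in
-- Sylvester's identity for the 3×3 Gram matrix at $i$, with pivot $\ell_{ij}^2$. It evaluates the
-- sine of the dihedral angle, and positivity of the right side keeps the cosine away from ±1.
lemma areaSq_mul_areaSq_sub (ℓ : V → V → ℝ) (i j k l : V) :
    areaSq ℓ i j k * areaSq ℓ i j l - crossGram ℓ i j k l ^ 2 = ℓ i j ^ 2 * gramDet ℓ i j k l := by
  simp only [crossGram, areaSq, gramDet]; ring

/-! ### Embedded tetrahedra -/

omit [Fintype V] [DecidableEq V] in
lemma isEmbedding_embed {ℓ : V → V → ℝ} {s : Finset V} (h : ∃ p, IsEmbedding ℓ s p) :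
    IsEmbedding ℓ s (embed ℓ s) :=
  Classical.epsilon_spec h

omit [Fintype V] [DecidableEq V] in
lemma IsEmbedding.norm_sub {ℓ : V → V → ℝ} {s : Finset V} {p : V → E3} (hp : IsEmbedding ℓ s p)
    {a b : V} (ha : a ∈ s) (hb : b ∈ s) (hab : a ≠ b) : ‖p b - p a‖ = ℓ a b := by
  rw [← hp.2 a ha b hb hab, dist_comm, dist_eq_norm]

omit [Fintype V] [DecidableEq V] in
lemma IsEmbedding.length_pos {ℓ : V → V → ℝ} {s : Finset V} {p : V → E3}
    (hp : IsEmbedding ℓ s p) {a b : V} (ha : a ∈ s) (hb : b ∈ s) (hab : a ≠ b) : 0 < ℓ a b := by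
  rw [← hp.2 a ha b hb hab, dist_pos]
  intro h
  exact hab (congrArg Subtype.val (hp.1.injective (a₁ := ⟨a, ha⟩) (a₂ := ⟨b, hb⟩) h))

omit [Fintype V] [DecidableEq V] in
lemma IsEmbedding.inner_self {ℓ : V → V → ℝ} {s : Finset V} {p : V → E3}
    (hp : IsEmbedding ℓ s p) {a b : V} (ha : a ∈ s) (hb : b ∈ s) (hab : a ≠ b) :
    inner ℝ (p b - p a) (p b - p a) = ℓ a b ^ 2 := by
  rw [real_inner_self_eq_norm_sq, hp.norm_sub ha hb hab]

omit [Fintype V] [DecidableEq V] in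
lemma IsEmbedding.inner_eq_gram {ℓ : V → V → ℝ} {s : Finset V} {p : V → E3}
    (hp : IsEmbedding ℓ s p) {a b c : V} (ha : a ∈ s) (hb : b ∈ s) (hc : c ∈ s)
    (hab : a ≠ b) (hac : a ≠ c) (hbc : b ≠ c) :
    inner ℝ (p b - p a) (p c - p a) = gram ℓ a b c := by
  have h := norm_sub_sq_real (p c - p a) (p b - p a)
  rw [sub_sub_sub_cancel_right, hp.norm_sub hb hc hbc, hp.norm_sub ha hb hab,
    hp.norm_sub ha hc hac, real_inner_comm] at h
  simp only [gram]
  linarith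

omit [Fintype V] in
lemma IsEmbedding.linearIndependent {ℓ : V → V → ℝ} {s : Finset V} {p : V → E3}
    (hp : IsEmbedding ℓ s p) {i j k l : V} (h : IsTetrahedron s i j k l) :
    LinearIndependent ℝ ![p j - p i, p k - p i, p l - p i] := by
  have hl := (affineIndependent_iff_linearIndependent_vsub ℝ _
    (⟨i, h.mem_fst⟩ : {a // a ∈ s})).1 hp.1
  let e : Fin 3 → {x : {a // a ∈ s} // x ≠ ⟨i, h.mem_fst⟩} :=
    ![⟨⟨j, h.mem_snd⟩, by simpa using h.ij.symm⟩, ⟨⟨k, h.mem_trd⟩, by simpa using h.ik.symm⟩,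
      ⟨⟨l, h.mem_fth⟩, by simpa using h.il.symm⟩]
  have he : Function.Injective e := by
    intro a b
    fin_cases a <;> fin_cases b <;>
      simp [e, h.jk, h.jl, h.kl, h.jk.symm, h.jl.symm, h.kl.symm]
  have hc : ![p j - p i, p k - p i, p l - p i] =
      (fun x : {x : {a // a ∈ s} // x ≠ ⟨i, h.mem_fst⟩} => p x.1 -ᵥ p i) ∘ e := by
    ext a
    fin_cases a <;> simp [e]
  rw [hc]
  exact hl.comp e he

omit [Fintype V] in
lemma IsEmbedding.gramDet_pos {ℓ : V → V → ℝ} {s : Finset V} {p : V → E3}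
    (hp : IsEmbedding ℓ s p) {i j k l : V} (h : IsTetrahedron s i j k l) :
    0 < gramDet ℓ i j k l := by
  have hd :=
    ((Matrix.posDef_gram_iff_linearIndependent (𝕜 := ℝ)).2 (hp.linearIndependent h)).det_pos
  have e1 := hp.inner_eq_gram h.mem_fst h.mem_snd h.mem_trd h.ij h.ik h.jk
  have e2 := hp.inner_eq_gram h.mem_fst h.mem_snd h.mem_fth h.ij h.il h.jl
  have e3 := hp.inner_eq_gram h.mem_fst h.mem_trd h.mem_fth h.ik h.il h.kl
  have e4 : inner ℝ (p k - p i) (p j - p i) = gram ℓ i j k := by rw [real_inner_comm, e1]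
  have e5 : inner ℝ (p l - p i) (p j - p i) = gram ℓ i j l := by rw [real_inner_comm, e2]
  have e6 : inner ℝ (p l - p i) (p k - p i) = gram ℓ i k l := by rw [real_inner_comm, e3]
  simp only [Matrix.det_fin_three, Matrix.gram_apply, Matrix.cons_val,
    hp.inner_self h.mem_fst h.mem_snd h.ij, hp.inner_self h.mem_fst h.mem_trd h.ik,
    hp.inner_self h.mem_fst h.mem_fth h.il, e1, e2, e3, e4, e5, e6] at hd
  simp only [gramDet]
  linarith

omit [Fintype V] in
lemma IsEmbedding.areaSq_pos {ℓ : V → V → ℝ} {s : Finset V} {p : V → E3}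
    (hp : IsEmbedding ℓ s p) {i j k l : V} (h : IsTetrahedron s i j k l) :
    0 < areaSq ℓ i j k := by
  have h0 : 0 ≤ areaSq ℓ i j k := by
    have := real_inner_mul_inner_self_le (p j - p i) (p k - p i)
    rw [hp.inner_eq_gram h.mem_fst h.mem_snd h.mem_trd h.ij h.ik h.jk,
      hp.inner_self h.mem_fst h.mem_snd h.ij,
      hp.inner_self h.mem_fst h.mem_trd h.ik] at this
    simp only [areaSq]
    linarith
  refine h0.lt_of_ne fun h1 => ?_
  -- A vanishing area would make the left side of Sylvester's identity nonpositive, while its right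
  -- side is positive.
  have h2 := areaSq_mul_areaSq_sub ℓ i j k l
  have h3 := mul_pos (pow_pos (hp.length_pos h.mem_fst h.mem_snd h.ij) 2) (hp.gramDet_pos h)
  rw [← h1] at h2
  nlinarith [sq_nonneg (crossGram ℓ i j k l)]

lemma inner_starProjection_orthogonal_span_singleton (e u v : E3) (he : e ≠ 0) :
    inner ℝ ((Submodule.span ℝ {e})ᗮ.starProjection u) ((Submodule.span ℝ {e})ᗮ.starProjection v)
      = (inner ℝ u v * inner ℝ e e - inner ℝ e u * inner ℝ e v) / inner ℝ e e := by
  have h0 : (inner ℝ e e : ℝ) ≠ 0 := by simpa using he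
  rw [Submodule.starProjection_orthogonal_val, Submodule.starProjection_orthogonal_val,
    Submodule.starProjection_singleton, Submodule.starProjection_singleton]
  have h1 : ((‖e‖ ^ 2 : ℝ)) = inner ℝ e e := (real_inner_self_eq_norm_sq e).symm
  simp only [RCLike.ofReal_real_eq_id, id_eq, h1, inner_sub_left, inner_sub_right,
    real_inner_smul_left, real_inner_smul_right]
  rw [real_inner_comm e u]
  field_simp
  ring

omit [Fintype V] in
-- Removes the arbitrary choice in `embed`: the projected vectors have inner products `crossGram`
-- and `areaSq` divided by $\ell_{ij}^2$, a factor that cancels in the cosine. The angle can then be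
-- differentiated in the lengths.
lemma dihedralAngle_eq_arccos {ℓ : V → V → ℝ} {s : Finset V} (hs : ∃ p, IsEmbedding ℓ s p)
    {i j k l : V} (h : IsTetrahedron s i j k l) :
    dihedralAngle ℓ s i j k l =
      Real.arccos (crossGram ℓ i j k l / (√(areaSq ℓ i j k) * √(areaSq ℓ i j l))) := by
  have hp := isEmbedding_embed hs
  have hL := hp.length_pos h.mem_fst h.mem_snd h.ij
  have he : embed ℓ s j - embed ℓ s i ≠ 0 := by
    rw [← norm_pos_iff, hp.norm_sub h.mem_fst h.mem_snd h.ij]; exact hL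
  have hA := hp.areaSq_pos h
  have hB := hp.areaSq_pos h.swap_right
  simp only [dihedralAngle, InnerProductGeometry.angle]
  congr 1
  rw [norm_eq_sqrt_real_inner, norm_eq_sqrt_real_inner]
  simp only [inner_starProjection_orthogonal_span_singleton _ _ _ he,
    hp.inner_self h.mem_fst h.mem_snd h.ij, hp.inner_self h.mem_fst h.mem_trd h.ik,
    hp.inner_self h.mem_fst h.mem_fth h.il,
    hp.inner_eq_gram h.mem_fst h.mem_snd h.mem_trd h.ij h.ik h.jk,
    hp.inner_eq_gram h.mem_fst h.mem_snd h.mem_fth h.ij h.il h.jl,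
    hp.inner_eq_gram h.mem_fst h.mem_trd h.mem_fth h.ik h.il h.kl]
  have e1 : ℓ i k ^ 2 * ℓ i j ^ 2 - gram ℓ i j k * gram ℓ i j k = areaSq ℓ i j k := by
    simp only [areaSq]; ring
  have e2 : ℓ i l ^ 2 * ℓ i j ^ 2 - gram ℓ i j l * gram ℓ i j l = areaSq ℓ i j l := by
    simp only [areaSq]; ring
  rw [e1, e2, Real.sqrt_div hA.le, Real.sqrt_div hB.le, Real.sqrt_sq hL.le]
  change crossGram ℓ i j k l / _ / _ = _
  have := Real.sqrt_pos.2 hA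
  have := Real.sqrt_pos.2 hB
  field_simp

/-! ### Cayley-Menger determinants -/

omit [Fintype V] in
lemma det_cayleyMenger_tetrahedron {ℓ : V → V → ℝ} (hℓ : ∀ a b, ℓ a b = ℓ b a)
    {s : Finset V} {i j k l : V} (h : IsTetrahedron s i j k l) :
    (cayleyMenger ℓ s).det = 8 * gramDet ℓ i j k l := by
  let e : Fin 5 → Option {a // a ∈ s} := ![none, some ⟨i, h.mem_fst⟩, some ⟨j, h.mem_snd⟩,
    some ⟨k, h.mem_trd⟩, some ⟨l, h.mem_fth⟩]
  have hinj : Function.Injective e := by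
    intro a b
    fin_cases a <;> fin_cases b <;>
      simp [e, h.ij, h.ik, h.il, h.jk, h.jl, h.kl, h.ij.symm, h.ik.symm, h.il.symm, h.jk.symm,
        h.jl.symm, h.kl.symm]
  have hsurj : Function.Surjective e := by
    rintro (_ | ⟨a, ha⟩)
    · exact ⟨0, rfl⟩
    · rw [h.eq] at ha
      simp only [Finset.mem_insert, Finset.mem_singleton] at ha
      obtain rfl | rfl | rfl | rfl := ha
      exacts [⟨1, rfl⟩, ⟨2, rfl⟩, ⟨3, rfl⟩, ⟨4, rfl⟩]
  rw [← Matrix.det_submatrix_equiv_self (Equiv.ofBijective e ⟨hinj, hsurj⟩)]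
  have hM : (cayleyMenger ℓ s).submatrix e e = !![0, 1, 1, 1, 1;
      1, 0, ℓ i j ^ 2, ℓ i k ^ 2, ℓ i l ^ 2; 1, ℓ i j ^ 2, 0, ℓ j k ^ 2, ℓ j l ^ 2;
      1, ℓ i k ^ 2, ℓ j k ^ 2, 0, ℓ k l ^ 2; 1, ℓ i l ^ 2, ℓ j l ^ 2, ℓ k l ^ 2, 0] := by
    ext a b
    fin_cases a <;> fin_cases b <;>
      simp [e, cayleyMenger, h.ij, h.ik, h.il, h.jk, h.jl, h.kl, h.ij.symm, h.ik.symm, h.il.symm,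
        h.jk.symm, h.jl.symm, h.kl.symm, hℓ j i, hℓ k i, hℓ l i, hℓ k j, hℓ l j, hℓ l k]
  change ((cayleyMenger ℓ s).submatrix e e).det = _
  rw [hM]
  simp [Matrix.det_succ_row_zero, Fin.sum_univ_succ, Fin.succAbove, gramDet, gram]
  ring

omit [Fintype V] in
lemma det_cayleyMenger_triangle {ℓ : V → V → ℝ} (hℓ : ∀ a b, ℓ a b = ℓ b a)
    {i j k : V} (hij : i ≠ j) (hik : i ≠ k) (hjk : j ≠ k) :
    (cayleyMenger ℓ {i, j, k}).det = -4 * areaSq ℓ i j k := by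
  let e : Fin 4 → Option {a // a ∈ ({i, j, k} : Finset V)} :=
    ![none, some ⟨i, by simp⟩, some ⟨j, by simp⟩, some ⟨k, by simp⟩]
  have hinj : Function.Injective e := by
    intro a b
    fin_cases a <;> fin_cases b <;> simp [e, hij, hik, hjk, hij.symm, hik.symm, hjk.symm]
  have hsurj : Function.Surjective e := by
    rintro (_ | ⟨a, ha⟩)
    · exact ⟨0, rfl⟩
    · have ha' := ha
      simp only [Finset.mem_insert, Finset.mem_singleton] at ha'
      obtain rfl | rfl | rfl := ha'
      exacts [⟨1, rfl⟩, ⟨2, rfl⟩, ⟨3, rfl⟩]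
  rw [← Matrix.det_submatrix_equiv_self (Equiv.ofBijective e ⟨hinj, hsurj⟩)]
  have hM : (cayleyMenger ℓ {i, j, k}).submatrix e e = !![0, 1, 1, 1;
      1, 0, ℓ i j ^ 2, ℓ i k ^ 2; 1, ℓ i j ^ 2, 0, ℓ j k ^ 2; 1, ℓ i k ^ 2, ℓ j k ^ 2, 0] := by
    ext a b
    fin_cases a <;> fin_cases b <;>
      simp [e, cayleyMenger, hij, hik, hjk, hij.symm, hik.symm, hjk.symm, hℓ j i, hℓ k i, hℓ k j]
  change ((cayleyMenger ℓ {i, j, k}).submatrix e e).det = _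
  rw [hM]
  simp [Matrix.det_succ_row_zero, Fin.sum_univ_succ, Fin.succAbove, areaSq, gram]
  ring

omit [Fintype V] in
lemma simplexVolume_tetrahedron {ℓ : V → V → ℝ} (hℓ : ∀ a b, ℓ a b = ℓ b a)
    {s : Finset V} {i j k l : V} (h : IsTetrahedron s i j k l) :
    simplexVolume ℓ s = √(gramDet ℓ i j k l) / 6 := by
  have hc : s.card = 4 := by
    rw [h.eq]; exact Finset.card_eq_four.2 ⟨i, j, k, l, h.ij, h.ik, h.il, h.jk, h.jl, h.kl, rfl⟩
  rw [simplexVolume, det_cayleyMenger_tetrahedron hℓ h, hc,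
    show (-1) ^ 4 * (8 * gramDet ℓ i j k l) / (2 ^ (4 - 1) * (Nat.factorial (4 - 1) : ℝ) ^ 2) =
      gramDet ℓ i j k l / 6 ^ 2 by norm_num [Nat.factorial]; ring,
    Real.sqrt_div' _ (by norm_num), Real.sqrt_sq (by norm_num)]

omit [Fintype V] in
lemma simplexVolume_triangle {ℓ : V → V → ℝ} (hℓ : ∀ a b, ℓ a b = ℓ b a)
    {i j k : V} (hij : i ≠ j) (hik : i ≠ k) (hjk : j ≠ k) :
    simplexVolume ℓ {i, j, k} = √(areaSq ℓ i j k) / 2 := by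
  rw [simplexVolume, det_cayleyMenger_triangle hℓ hij hik hjk,
    Finset.card_eq_three.2 ⟨i, j, k, hij, hik, hjk, rfl⟩,
    show (-1) ^ 3 * (-4 * areaSq ℓ i j k) / (2 ^ (3 - 1) * (Nat.factorial (3 - 1) : ℝ) ^ 2) =
      areaSq ℓ i j k / 2 ^ 2 by norm_num [Nat.factorial]; ring,
    Real.sqrt_div' _ (by norm_num), Real.sqrt_sq (by norm_num)]

/-! ### Symmetries of dihedral angles -/

omit [Fintype V] in
lemma dihedralAngle_swap_left {ℓ : V → V → ℝ} (hℓ : ∀ a b, ℓ a b = ℓ b a) {s : Finset V}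
    (hs : ∃ p, IsEmbedding ℓ s p) {i j k l : V} (h : IsTetrahedron s i j k l) :
    dihedralAngle ℓ s j i k l = dihedralAngle ℓ s i j k l := by
  rw [dihedralAngle_eq_arccos hs h, dihedralAngle_eq_arccos hs h.swap_left,
    crossGram_swap_left hℓ, areaSq_swap_left hℓ i j k, areaSq_swap_left hℓ i j l]

omit [Fintype V] in
lemma dihedralAngle_swap_right {ℓ : V → V → ℝ} (hℓ : ∀ a b, ℓ a b = ℓ b a) {s : Finset V}
    (hs : ∃ p, IsEmbedding ℓ s p) {i j k l : V} (h : IsTetrahedron s i j k l) :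
    dihedralAngle ℓ s i j l k = dihedralAngle ℓ s i j k l := by
  rw [dihedralAngle_eq_arccos hs h, dihedralAngle_eq_arccos hs h.swap_right,
    crossGram_swap_right hℓ, mul_comm √(areaSq ℓ i j l)]

/-! ### Sums over the edges of a tetrahedron -/

omit [Fintype V] in
lemma IsTetrahedron.sdiff_pair {s : Finset V} {i j k l : V} (h : IsTetrahedron s i j k l) :
    s \ {i, j} = {k, l} := by
  ext a
  simp only [h.eq, Finset.mem_sdiff, Finset.mem_insert, Finset.mem_singleton]
  have := h.ik; have := h.il; have := h.jk; have := h.jl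
  grind

omit [Fintype V] in
lemma sum_offDiag_eq (s : Finset V) (f : V × V → ℝ) :
    ∑ q ∈ s.offDiag, f q = ∑ a ∈ s, ∑ b ∈ s, if a ≠ b then f (a, b) else 0 := by
  rw [← Finset.sum_product', ← Finset.sum_filter]
  refine Finset.sum_congr ?_ fun _ _ => rfl
  ext q
  simp [and_assoc]

omit [Fintype V] in
lemma sum_offDiag_pair {k l : V} (hkl : k ≠ l) (f : V × V → ℝ) :
    ∑ q ∈ ({k, l} : Finset V).offDiag, f q = f (k, l) + f (l, k) := by
  rw [sum_offDiag_eq]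
  simp [hkl, hkl.symm, Finset.sum_pair hkl]

omit [Fintype V] in
lemma IsTetrahedron.sum_offDiag {s : Finset V} {i j k l : V} (h : IsTetrahedron s i j k l)
    (f : V × V → ℝ) :
    ∑ q ∈ s.offDiag, f q =
      (f (i, j) + f (j, i)) + (f (i, k) + f (k, i)) + (f (i, l) + f (l, i)) +
      (f (j, k) + f (k, j)) + (f (j, l) + f (l, j)) + (f (k, l) + f (l, k)) := by
  rw [sum_offDiag_eq, h.eq]
  simp [Finset.sum_insert, h.ij, h.ik, h.il, h.jk, h.jl, h.kl, h.ij.symm, h.ik.symm, h.il.symm,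
    h.jk.symm, h.jl.symm, h.kl.symm]
  ring

omit [Fintype V] in
-- The factor 4 counts two orientations of each edge times two orders of the remaining vertices.
lemma IsTetrahedron.sum_offDiag_sdiff {s : Finset V} {i j k l : V} (h : IsTetrahedron s i j k l)
    (g : V → V → V → V → ℝ)
    (hl : ∀ i j k l, IsTetrahedron s i j k l → g j i k l = g i j k l)
    (hr : ∀ i j k l, IsTetrahedron s i j k l → g i j l k = g i j k l) :
    ∑ q ∈ s.offDiag, ∑ r ∈ (s \ {q.1, q.2}).offDiag, g q.1 q.2 r.1 r.2 =
      4 * (g i j k l + g i k j l + g i l j k + g j k i l + g j l i k + g k l i j) := by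
  have key : ∀ i j k l, IsTetrahedron s i j k l →
      ∑ r ∈ (s \ {i, j}).offDiag, g i j r.1 r.2 + ∑ r ∈ (s \ {j, i}).offDiag, g j i r.1 r.2
        = 4 * g i j k l := by
    intro i j k l h
    rw [h.sdiff_pair, h.swap_left.sdiff_pair, sum_offDiag_pair h.kl, sum_offDiag_pair h.kl,
      hl _ _ _ _ h, hl _ _ _ _ h.swap_right, hr _ _ _ _ h]
    ring
  rw [h.sum_offDiag]
  linarith [key _ _ _ _ h, key _ _ _ _ h.swap_mid, key _ _ _ _ h.swap_right.swap_mid,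
    key _ _ _ _ h.swap_left.swap_mid, key _ _ _ _ h.swap_left.swap_right.swap_mid,
    key _ _ _ _ h.swap_mid.swap_left.swap_right.swap_mid]

/-! ### The Schläfli formula -/

/-- With cosine $F/\sqrt{QR}$, the hypothesis `h` says that the sine is $a\sqrt D/\sqrt{QR}$. It is
positive, so `arccos` is differentiable there, and the roots of $Q$ and $R$ cancel from the
quotient. In the application $a$ is the edge length, which Schläfli's weighting removes. -/
lemma hasDerivAt_arccos_div_sqrt {F Q R : ℝ → ℝ} {F' Q' R' a D t : ℝ} (hF : HasDerivAt F F' t)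
    (hQ : HasDerivAt Q Q' t) (hR : HasDerivAt R R' t) (hQ0 : 0 < Q t) (hR0 : 0 < R t)
    (ha : 0 < a) (hD : 0 < D) (h : Q t * R t - F t ^ 2 = a ^ 2 * D) :
    HasDerivAt (fun t => Real.arccos (F t / (√(Q t) * √(R t))))
      (-(F' - F t * (Q' / (2 * Q t) + R' / (2 * R t))) / (a * √D)) t := by
  have hq := Real.sqrt_pos.2 hQ0
  have hr := Real.sqrt_pos.2 hR0
  have hd := Real.sqrt_pos.2 hD
  have hq2 := Real.sq_sqrt hQ0.le
  have hr2 := Real.sq_sqrt hR0.le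
  have hd2 := Real.sq_sqrt hD.le
  have hx : 1 - (F t / (√(Q t) * √(R t))) ^ 2 = (a * √D / (√(Q t) * √(R t))) ^ 2 := by
    field_simp
    rw [hq2, hr2, hd2]
    linarith
  have hpos : 0 < a * √D / (√(Q t) * √(R t)) := by positivity
  have hlt : (F t / (√(Q t) * √(R t))) ^ 2 < 1 := by nlinarith
  have hne : F t / (√(Q t) * √(R t)) ≠ -1 ∧ F t / (√(Q t) * √(R t)) ≠ 1 := by
    constructor <;> intro h1 <;> rw [h1] at hlt <;> norm_num at hlt
  have h1 := (Real.hasDerivAt_arccos hne.1 hne.2).comp t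
    (hF.div ((hQ.sqrt hQ0.ne').mul (hR.sqrt hR0.ne')) (mul_pos hq hr).ne')
  refine h1.congr_deriv ?_
  simp only [Pi.mul_apply]
  rw [hx, Real.sqrt_sq hpos.le]
  generalize √(Q t) = q at *
  generalize √(R t) = r at *
  generalize √D = d at *
  rw [← hq2, ← hr2]
  field_simp

section deformation

variable {L : ℝ → V → V → ℝ} {t : ℝ} (hL : ∀ a b, DifferentiableAt ℝ (fun t => L t a b) t)
include hL

omit [Fintype V] [DecidableEq V] in
lemma differentiableAt_areaSq (i j k : V) :
    DifferentiableAt ℝ (fun t => areaSq (L t) i j k) t := by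
  simp only [areaSq, gram]; fun_prop

omit [Fintype V] [DecidableEq V] in
lemma differentiableAt_crossGram (i j k l : V) :
    DifferentiableAt ℝ (fun t => crossGram (L t) i j k l) t := by
  simp only [crossGram, gram]; fun_prop

omit [Fintype V] [DecidableEq V] in
lemma deriv_crossGram_add_add (hs : ∀ t a b, L t a b = L t b a) (i j k l : V) :
    deriv (fun t => crossGram (L t) i j k l) t + deriv (fun t => crossGram (L t) i k j l) t +
      deriv (fun t => crossGram (L t) j k i l) t = deriv (fun t => areaSq (L t) i j k) t := by
  have h := ((differentiableAt_crossGram hL i j k l).hasDerivAt.add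
    (differentiableAt_crossGram hL i k j l).hasDerivAt).add
    (differentiableAt_crossGram hL j k i l).hasDerivAt
  rw [← h.deriv]
  congr 1
  ext u
  exact crossGram_add_add (hs u) i j k l

variable {s : Finset V} (he : ∀ᶠ u in nhds t, ∃ p, IsEmbedding (L u) s p)
include he

omit [Fintype V] in
lemma hasDerivAt_dihedralAngle {i j k l : V} (h : IsTetrahedron s i j k l) :
    HasDerivAt (fun u => dihedralAngle (L u) s i j k l)
      (-(deriv (fun u => crossGram (L u) i j k l) t - crossGram (L t) i j k l *
        (deriv (fun u => areaSq (L u) i j k) t / (2 * areaSq (L t) i j k) +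
          deriv (fun u => areaSq (L u) i j l) t / (2 * areaSq (L t) i j l))) /
        (L t i j * √(gramDet (L t) i j k l))) t := by
  obtain ⟨p, hp⟩ := he.self_of_nhds
  refine (hasDerivAt_arccos_div_sqrt (differentiableAt_crossGram hL i j k l).hasDerivAt
    (differentiableAt_areaSq hL i j k).hasDerivAt (differentiableAt_areaSq hL i j l).hasDerivAt
    (hp.areaSq_pos h) (hp.areaSq_pos h.swap_right) (hp.length_pos h.mem_fst h.mem_snd h.ij)
    (hp.gramDet_pos h) (areaSq_mul_areaSq_sub _ i j k l)).congr_of_eventuallyEq ?_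
  filter_upwards [he] with u hu
  exact dihedralAngle_eq_arccos hu h

omit [Fintype V] in
/-- The Schläfli formula: under a deformation of a Euclidean tetrahedron, the derivatives of the
dihedral angles, weighted by the edge lengths, add up to zero. -/
lemma schlaefli (hs : ∀ t a b, L t a b = L t b a) (hcard : s.card = 4) :
    ∑ q ∈ s.offDiag, ∑ r ∈ (s \ {q.1, q.2}).offDiag,
      L t q.1 q.2 * deriv (fun u => dihedralAngle (L u) s q.1 q.2 r.1 r.2) t = 0 := by
  obtain ⟨p, hp⟩ := he.self_of_nhds
  obtain ⟨i, j, k, l, h⟩ := exists_isTetrahedron hcard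
  set Q' : V → V → V → ℝ := fun i j k => deriv (fun u => areaSq (L u) i j k) t with hQ'
  set F' : V → V → V → V → ℝ := fun i j k l => deriv (fun u => crossGram (L u) i j k l) t with hF'
  set Q : V → V → V → ℝ := areaSq (L t) with hQ
  set F : V → V → V → V → ℝ := crossGram (L t) with hF
  have Ql : ∀ i j k, Q j i k = Q i j k := areaSq_swap_left (hs t)
  have Qr : ∀ i j k, Q i k j = Q i j k := areaSq_swap_right (hs t)
  have Fr : ∀ i j k l, F i j l k = F i j k l := crossGram_swap_right (hs t)
  have Ql' : ∀ i j k, Q' j i k = Q' i j k := fun i j k => by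
    simp only [hQ', areaSq_swap_left (hs _) i j k]
  have Qr' : ∀ i j k, Q' i k j = Q' i j k := fun i j k => by
    simp only [hQ', areaSq_swap_right (hs _) i j k]
  have Fr' : ∀ i j k l, F' i j l k = F' i j k l := fun i j k l => by
    simp only [hF', crossGram_swap_right (hs _) i j k l]
  set d := √(gramDet (L t) i j k l) with hd
  have hc : ∀ x y z : ℝ, x ≠ 0 → z ≠ 0 → x * (y / (x * z)) * z = y := by
    intro x y z hx hz
    field_simp
  -- Weighting by the edge length leaves $\sqrt D$ as the only denominator; it is the same for all
  -- six edges.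
  have hD : ∀ a b c e, IsTetrahedron s a b c e → L t a b *
      deriv (fun u => dihedralAngle (L u) s a b c e) t * √(gramDet (L t) a b c e) =
      -(F' a b c e - F a b c e * (Q' a b c / (2 * Q a b c) + Q' a b e / (2 * Q a b e))) := by
    intro a b c e h
    have h1 := (hp.length_pos h.mem_fst h.mem_snd h.ij).ne'
    have h2 := (Real.sqrt_pos.2 (hp.gramDet_pos h)).ne'
    rw [(hasDerivAt_dihedralAngle hL he h).deriv]
    exact hc _ _ _ h1 h2
  have hdl : ∀ i j k l, gramDet (L t) j i k l = gramDet (L t) i j k l := gramDet_swap_left (hs t)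
  have hdm : ∀ i j k l, gramDet (L t) i k j l = gramDet (L t) i j k l := gramDet_swap_mid (hs t)
  have hdr : ∀ i j k l, gramDet (L t) i j l k = gramDet (L t) i j k l := gramDet_swap_right (hs t)
  have hd0 : d ≠ 0 := (Real.sqrt_pos.2 (hp.gramDet_pos h)).ne'
  rw [h.sum_offDiag_sdiff (fun a b c e => L t a b *
    deriv (fun u => dihedralAngle (L u) s a b c e) t)]
  · have e1 := hD i j k l h
    have e2 := hD i k j l h.swap_mid
    have e3 := hD i l j k h.swap_right.swap_mid
    have e4 := hD j k i l h.swap_left.swap_mid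
    have e5 := hD j l i k h.swap_left.swap_right.swap_mid
    have e6 := hD k l i j h.swap_mid.swap_right.swap_left.swap_mid
    rw [hdm] at e2
    rw [hdm, hdr] at e3
    rw [hdm, hdl] at e4
    rw [hdm, hdr, hdl] at e5
    rw [hdm, hdl, hdr, hdm] at e6
    rw [← hd] at e1 e2 e3 e4 e5 e6
    rw [Qr i j k, Qr' i j k] at e2
    rw [Qr i j l, Qr i k l, Qr' i j l, Qr' i k l] at e3
    rw [Qr j i k, Qr' j i k, Ql i j k, Ql' i j k] at e4
    rw [Qr j i l, Qr' j i l, Ql i j l, Ql' i j l, Qr j k l, Qr' j k l] at e5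
    rw [Qr k i l, Qr' k i l, Ql i k l, Ql' i k l, Qr k j l, Qr' k j l, Ql j k l, Ql' j k l] at e6
    have f1 : F i j k l + F i k j l + F j k i l = Q i j k := crossGram_add_add (hs t) i j k l
    have f2 : F i j l k + F i l j k + F j l i k = Q i j l := crossGram_add_add (hs t) i j l k
    have f3 : F i k l j + F i l k j + F k l i j = Q i k l := crossGram_add_add (hs t) i k l j
    have f4 : F j k l i + F j l k i + F k l j i = Q j k l := crossGram_add_add (hs t) j k l i
    have g1 : F' i j k l + F' i k j l + F' j k i l = Q' i j k :=
      deriv_crossGram_add_add hL hs i j k l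
    have g2 : F' i j l k + F' i l j k + F' j l i k = Q' i j l :=
      deriv_crossGram_add_add hL hs i j l k
    have g3 : F' i k l j + F' i l k j + F' k l i j = Q' i k l :=
      deriv_crossGram_add_add hL hs i k l j
    have g4 : F' j k l i + F' j l k i + F' k l j i = Q' j k l :=
      deriv_crossGram_add_add hL hs j k l i
    rw [Fr i j k l] at f2
    rw [Fr i k j l, Fr i l j k] at f3
    rw [Fr j k i l, Fr j l i k, Fr k l i j] at f4
    rw [Fr' i j k l] at g2
    rw [Fr' i k j l, Fr' i l j k] at g3
    rw [Fr' j k i l, Fr' j l i k, Fr' k l i j] at g4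
    -- The quotients $c = Q'/2Q$ are about to become opaque; $Q' = 2cQ$ is all that is needed of
    -- them.
    have hr : ∀ a b c e, IsTetrahedron s a b c e →
        Q' a b c = 2 * (Q' a b c / (2 * Q a b c)) * Q a b c := by
      intro a b c e h
      have : Q a b c ≠ 0 := (hp.areaSq_pos h).ne'
      field_simp
    have r1 := hr _ _ _ _ h
    have r2 := hr _ _ _ _ h.swap_right
    have r3 := hr _ _ _ _ h.swap_mid.swap_right
    have r4 := hr _ _ _ _ h.swap_left.swap_mid.swap_right
    generalize Q' i j k / (2 * Q i j k) = c1 at *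
    generalize Q' i j l / (2 * Q i j l) = c2 at *
    generalize Q' i k l / (2 * Q i k l) = c3 at *
    generalize Q' j k l / (2 * Q j k l) = c4 at *
    refine (mul_eq_zero.1 ?_).resolve_right hd0
    -- Each edge lies in two faces, so four times the sum of the six $F'$ is twice the sum of the
    -- four $Q'$. Each $c$ multiplies the three $F$ of its face, which add up to $Q$, and $4cQ =
    -- 2Q'$.
    linear_combination 4 * (e1 + e2 + e3 + e4 + e5 + e6) - 2 * (g1 + g2 + g3 + g4)
      + 4 * (c1 * f1 + c2 * f2 + c3 * f3 + c4 * f4) - 2 * (r1 + r2 + r3 + r4)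
  · intro a b c e h
    rw [hs t b a]
    congr 1
    refine Filter.EventuallyEq.deriv_eq ?_
    filter_upwards [he] with u hu
    rw [dihedralAngle_swap_left (hs u) hu h]
  · intro a b c e h
    congr 1
    refine Filter.EventuallyEq.deriv_eq ?_
    filter_upwards [he] with u hu
    rw [dihedralAngle_swap_right (hs u) hu h]

end deformation

/-! ### Faces of triangulations -/

omit [Fintype V] [DecidableEq V] in
lemma mem_of_subset_face {T : AbstractSimplicialComplex V} {s t : Finset V} (hs : s ∈ T)
    (hts : t ⊆ s) (ht : t.Nonempty) : t ∈ T :=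
  (T.isRelLowerSet_faces hs).2 hts ht

omit [Fintype V] in
lemma Adj.symm {T : AbstractSimplicialComplex V} {i j : V} (h : Adj T i j) : Adj T j i :=
  ⟨h.1.symm, by rw [Finset.pair_comm]; exact h.2⟩

omit [Fintype V] in
lemma adj_of_mem {T : AbstractSimplicialComplex V} {s : Finset V} (hs : s ∈ T) {i j : V}
    (hi : i ∈ s) (hj : j ∈ s) (hij : i ≠ j) : Adj T i j :=
  ⟨hij, mem_of_subset_face hs (by simp [Finset.insert_subset_iff, hi, hj]) (by simp)⟩

omit [DecidableEq V] in
lemma mem_tetrahedra {T : AbstractSimplicialComplex V} {s : Finset V} :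
    s ∈ tetrahedra T ↔ s ∈ T ∧ s.card = 4 := by
  simp [tetrahedra]

omit [Fintype V] in
lemma isTetrahedron_of_mem_offDiag {s : Finset V} (hs : s.card = 4) {i j : V} (hi : i ∈ s)
    (hj : j ∈ s) (hij : i ≠ j) {r : V × V} (hr : r ∈ (s \ {i, j}).offDiag) :
    IsTetrahedron s i j r.1 r.2 := by
  simp only [Finset.mem_offDiag, Finset.mem_sdiff, Finset.mem_insert, Finset.mem_singleton,
    not_or] at hr
  obtain ⟨⟨h1, h2, h3⟩, ⟨h4, h5, h6⟩, h7⟩ := hr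
  refine ⟨hij, Ne.symm h2, Ne.symm h5, Ne.symm h3, Ne.symm h6, h7, ?_⟩
  refine (Finset.eq_of_subset_of_card_le ?_ ?_).symm
  · simp [Finset.insert_subset_iff, hi, hj, h1, h4]
  · rw [hs, Finset.card_eq_four.2
      ⟨i, j, r.1, r.2, hij, Ne.symm h2, Ne.symm h5, Ne.symm h3, Ne.symm h6, h7, rfl⟩]

open Classical in
lemma sum_edges_offDiag (T : AbstractSimplicialComplex V) (G : V × V → ℝ) :
    ∑ e ∈ edges T, ∑ q ∈ e.offDiag, G q =
      ∑ q ∈ Finset.univ.filter (fun q : V × V => Adj T q.1 q.2), G q := by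
  rw [← Finset.sum_fiberwise_of_maps_to (t := edges T) (g := fun q : V × V => {q.1, q.2})]
  · refine Finset.sum_congr rfl fun e he => Finset.sum_congr ?_ fun _ _ => rfl
    simp only [edges, Finset.mem_filter, Finset.mem_univ, true_and] at he
    ext q
    simp only [Finset.mem_offDiag, Finset.mem_filter, Finset.mem_univ, true_and]
    constructor
    · rintro ⟨h1, h2, h3⟩
      have : ({q.1, q.2} : Finset V) = e := Finset.eq_of_subset_of_card_le
        (by simp [Finset.insert_subset_iff, h1, h2]) (by rw [he.2, Finset.card_pair h3])
      exact ⟨⟨h3, by rw [this]; exact he.1⟩, this⟩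
    · rintro ⟨⟨h1, -⟩, rfl⟩
      simp [h1]
  · intro q hq
    simp only [Finset.mem_filter, Finset.mem_univ, true_and] at hq
    simp only [edges, Finset.mem_filter, Finset.mem_univ, true_and]
    exact ⟨hq.2, Finset.card_pair hq.1⟩

open Classical in
-- Exchanges edges and tetrahedra, so that Schläfli's formula can be applied inside each
-- tetrahedron.
lemma sum_adj_sum_tetrahedra (T : AbstractSimplicialComplex V) (H : Finset V → V × V → ℝ) :
    ∑ q ∈ Finset.univ.filter (fun q : V × V => Adj T q.1 q.2),
        ∑ s ∈ (tetrahedra T).filter (fun s => q.1 ∈ s ∧ q.2 ∈ s), H s q =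
      ∑ s ∈ tetrahedra T, ∑ q ∈ s.offDiag, H s q := by
  refine Finset.sum_comm' fun q s => ?_
  simp only [Finset.mem_filter, Finset.mem_univ, true_and, Finset.mem_offDiag]
  constructor
  · rintro ⟨h1, h2, h3, h4⟩
    exact ⟨⟨h3, h4, h1.1⟩, h2⟩
  · rintro ⟨⟨h1, h2, h3⟩, h4⟩
    exact ⟨adj_of_mem (mem_tetrahedra.1 h4).1 h1 h2 h3, h4, h1, h2⟩

/-! ### The variation of the Einstein-Hilbert-Regge functional -/

lemma deficit_comm {T : AbstractSimplicialComplex V} {ℓ : V → V → ℝ} (hℓ : ∀ a b, ℓ a b = ℓ b a)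
    (hT : IsPiecewiseFlat T ℓ) {i j : V} (hij : i ≠ j) : deficit T ℓ j i = deficit T ℓ i j := by
  simp only [deficit]
  congr 1
  refine Finset.sum_congr (by ext; simp [and_comm]) fun s hs => ?_
  simp only [Finset.mem_filter, mem_tetrahedra] at hs
  rw [Finset.pair_comm]
  congr 1
  refine Finset.sum_congr rfl fun r hr => ?_
  exact dihedralAngle_swap_left hℓ (hT s hs.1.1)
    (isTetrahedron_of_mem_offDiag hs.1.2 hs.2.1 hs.2.2 hij hr)

section deformation

variable {L : ℝ → V → V → ℝ} {t : ℝ} (hL : ∀ a b, DifferentiableAt ℝ (fun t => L t a b) t)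
  {T : AbstractSimplicialComplex V} (hT : ∀ᶠ u in nhds t, IsPiecewiseFlat T (L u))
include hL hT

lemma hasDerivAt_deficit {i j : V} (hij : i ≠ j) :
    HasDerivAt (fun u => deficit T (L u) i j)
      (-∑ s ∈ (tetrahedra T).filter (fun s => i ∈ s ∧ j ∈ s),
        (1 / 2) * ∑ r ∈ (s \ {i, j}).offDiag,
          deriv (fun u => dihedralAngle (L u) s i j r.1 r.2) t) t := by
  simp only [deficit]
  refine HasDerivAt.const_sub _ (HasDerivAt.fun_sum fun s hs => ?_)
  simp only [Finset.mem_filter, mem_tetrahedra] at hs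
  refine HasDerivAt.const_mul _ (HasDerivAt.fun_sum fun r hr => ?_)
  exact (hasDerivAt_dihedralAngle hL (hT.mono fun u hu => hu s hs.1.1)
    (isTetrahedron_of_mem_offDiag hs.1.2 hs.2.1 hs.2.2 hij hr)).differentiableAt.hasDerivAt

open Classical in
/-- Regge's variation formula. -/
lemma hasDerivAt_EHR (hs : ∀ t a b, L t a b = L t b a) :
    HasDerivAt (fun u => EHR T (L u))
      ((1 / 2) * ∑ q ∈ Finset.univ.filter (fun q : V × V => Adj T q.1 q.2),
        deficit T (L t) q.1 q.2 * deriv (fun u => L u q.1 q.2) t) t := by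
  simp only [EHR, ← Finset.mul_sum, sum_edges_offDiag]
  refine HasDerivAt.const_mul _ ?_
  have h := HasDerivAt.fun_sum
    (u := Finset.univ.filter (fun q : V × V => Adj T q.1 q.2)) fun q hq =>
      (hasDerivAt_deficit hL hT (Finset.mem_filter.1 hq).2.1).mul (hL q.1 q.2).hasDerivAt
  refine h.congr_deriv ?_
  -- What remains is that the terms containing derivatives of the deficits add up to zero.
  rw [Finset.sum_add_distrib, add_eq_right]
  simp only [neg_mul, Finset.sum_neg_distrib, neg_eq_zero, Finset.sum_mul]
  rw [sum_adj_sum_tetrahedra T fun s q => (1 / 2 * ∑ r ∈ (s \ {q.1, q.2}).offDiag,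
    deriv (fun u => dihedralAngle (L u) s q.1 q.2 r.1 r.2) t) * L t q.1 q.2]
  refine Finset.sum_eq_zero fun s hs' => ?_
  have h := mem_tetrahedra.1 hs'
  rw [← mul_zero (1 / 2 : ℝ),
    ← schlaefli hL (hT.mono fun u hu => hu s h.1) hs h.2, Finset.mul_sum]
  refine Finset.sum_congr rfl fun q _ => ?_
  rw [← Finset.mul_sum]
  ring

end deformation

/-! ### Variation of the volume of a tetrahedron -/

/-- For a vector `y` with inner products `x j`, `x k`, `x l` with the edge vectors at `i`, this is
the signed height of `y` over the plane of `i`, `j`, `k`, times four times the squared area of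
that triangle, times the height of `l` over that plane. -/
def heightDet (ℓ : V → V → ℝ) (x : V → ℝ) (i j k l : V) : ℝ :=
  areaSq ℓ i j k * x l - crossGram ℓ i k j l * x j - crossGram ℓ i j k l * x k

omit [Fintype V] [DecidableEq V] in
-- Only the three lengths at $i$ move. The numbers `δ a * L t i a` are half the derivatives of their
-- squares, and the result splits into one term for each face containing $i$.
lemma hasDerivAt_gramDet {L : ℝ → V → V → ℝ} {t : ℝ} {δ : V → ℝ} {i j k l : V}
    (hs : ∀ t a b, L t a b = L t b a)
    (hj : HasDerivAt (fun u => L u i j) (δ j) t) (hk : HasDerivAt (fun u => L u i k) (δ k) t)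
    (hl : HasDerivAt (fun u => L u i l) (δ l) t) (hjk : HasDerivAt (fun u => L u j k) 0 t)
    (hjl : HasDerivAt (fun u => L u j l) 0 t) (hkl : HasDerivAt (fun u => L u k l) 0 t) :
    HasDerivAt (fun u => gramDet (L u) i j k l)
      (2 * (heightDet (L t) (fun a => δ a * L t i a) i j k l +
        heightDet (L t) (fun a => δ a * L t i a) i j l k +
        heightDet (L t) (fun a => δ a * L t i a) i k l j)) t := by
  have a := hj.fun_pow 2
  have b := hk.fun_pow 2
  have c := hl.fun_pow 2
  have u := ((a.fun_add b).fun_sub (hjk.fun_pow 2)).div_const 2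
  have v := ((b.fun_add c).fun_sub (hkl.fun_pow 2)).div_const 2
  have w := ((a.fun_add c).fun_sub (hjl.fun_pow 2)).div_const 2
  have h := ((((a.fun_mul b).fun_mul c).fun_add (((u.const_mul 2).fun_mul v).fun_mul w)).fun_sub
    (a.fun_mul (v.fun_pow 2))).fun_sub (b.fun_mul (w.fun_pow 2)) |>.fun_sub
    (c.fun_mul (u.fun_pow 2))
  refine h.congr_deriv ?_
  simp only [heightDet, areaSq, crossGram, gram, hs t k j, hs t l j, hs t l k]
  push_cast
  ring

/-- Gram–Schmidt without division: orthogonality determines $W$ and $X$ from $\beta,\gamma$, and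
after substitution both claims are polynomial identities. -/
lemma norm_sub_smul_sub_smul_of_orthogonal {e₁ e₂ e₃ y : E3} {β γ A U B W X C x₁ x₂ x₃ : ℝ}
    (hA : inner ℝ e₁ e₁ = A) (hU : inner ℝ e₁ e₂ = U) (hB : inner ℝ e₂ e₂ = B)
    (hW : inner ℝ e₁ e₃ = W) (hX : inner ℝ e₂ e₃ = X) (hC : inner ℝ e₃ e₃ = C)
    (h₁ : inner ℝ y e₁ = x₁) (h₂ : inner ℝ y e₂ = x₂) (h₃ : inner ℝ y e₃ = x₃)
    (o₁ : inner ℝ (e₃ - (β • e₁ + γ • e₂)) e₁ = 0)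
    (o₂ : inner ℝ (e₃ - (β • e₁ + γ • e₂)) e₂ = 0) :
    (A * B - U ^ 2) * ‖e₃ - (β • e₁ + γ • e₂)‖ ^ 2 =
        A * B * C + 2 * U * X * W - A * X ^ 2 - B * W ^ 2 - C * U ^ 2 ∧
      (A * B - U ^ 2) * inner ℝ (e₃ - (β • e₁ + γ • e₂)) y =
        (A * B - U ^ 2) * x₃ - (W * B - U * X) * x₁ - (X * A - U * W) * x₂ := by
  have hU' : inner ℝ e₂ e₁ = U := by rw [real_inner_comm, hU]
  have hW' : inner ℝ e₃ e₁ = W := by rw [real_inner_comm, hW]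
  have hX' : inner ℝ e₃ e₂ = X := by rw [real_inner_comm, hX]
  rw [real_inner_comm] at h₁ h₂ h₃
  rw [← real_inner_self_eq_norm_sq]
  simp only [inner_sub_left, inner_sub_right, inner_add_left, inner_add_right,
    real_inner_smul_left, real_inner_smul_right, hA, hU, hB, hW, hX, hC, hU', hW', hX',
    h₁, h₂, h₃] at o₁ o₂ ⊢
  clear hU' hW' hX' hU hW hX
  have hW' : W = β * A + γ * U := by linarith
  have hX' : X = β * U + γ * B := by linarith
  subst hW' hX'
  constructor <;> ring

/-! ### Centers -/

omit [Fintype V] in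
lemma len_comm {T : AbstractSimplicialComplex V} (d : DirEdge T → ℝ) (a b : V) :
    len d a b = len d b a :=
  add_comm _ _

omit [Fintype V] in
lemma inner_sub_lineMap_eq_zero_iff {T : AbstractSimplicialComplex V} {d : DirEdge T → ℝ}
    {s : Finset V} {p : V → E3} (hp : IsEmbedding (len d) s p) {a b : V} (ha : a ∈ s)
    (hb : b ∈ s) (hab : a ≠ b) (c : E3) :
    inner ℝ (c - AffineMap.lineMap (p a) (p b) (dval d a b / len d a b)) (p b - p a) = (0 : ℝ) ↔
      inner ℝ (c - p a) (p b - p a) = dval d a b * len d a b := by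
  have hpos := (hp.length_pos ha hb hab).ne'
  have h : c - AffineMap.lineMap (p a) (p b) (dval d a b / len d a b) =
      (c - p a) - (dval d a b / len d a b) • (p b - p a) := by
    rw [AffineMap.lineMap_apply]
    simp only [vsub_eq_sub, vadd_eq_add]
    abel
  rw [h, inner_sub_left, real_inner_smul_left, hp.inner_self ha hb hab, sub_eq_zero]
  field_simp

omit [Fintype V] in
/-- Every tetrahedron has a center. -/
lemma exists_center {T : AbstractSimplicialComplex V} {d : DirEdge T → ℝ} (hd : d ∈ met T)
    {s : Finset V} (hs : s ∈ T) {p : V → E3} (hp : IsEmbedding (len d) s p)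
    {i j k l : V} (h : IsTetrahedron s i j k l) :
    ∃ c : E3, ∀ a ∈ s, ∀ b ∈ s, a ≠ b →
      inner ℝ (c - p a) (p b - p a) = dval d a b * len d a b := by
  have hD := (hp.gramDet_pos h).ne'
  set x : V → ℝ := fun a => dval d i a * len d i a with hx
  set ℓ := len d with hℓ
  have ls : ∀ a b, ℓ a b = ℓ b a := len_comm d
  -- Cramer's rule: `z` is the vector with prescribed inner products `x a` with the three edge
  -- vectors at `i`.
  set z : E3 := (heightDet ℓ x i k l j / gramDet ℓ i j k l) • (p j - p i) +
    (heightDet ℓ x i j l k / gramDet ℓ i j k l) • (p k - p i) +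
    (heightDet ℓ x i j k l / gramDet ℓ i j k l) • (p l - p i) with hz
  have hzi : ∀ a ∈ s, i ≠ a → inner ℝ z (p a - p i) = x a := by
    intro a ha hia
    rw [h.eq] at ha
    simp only [Finset.mem_insert, Finset.mem_singleton, hia.symm, false_or] at ha
    obtain rfl | rfl | rfl := ha
    · rw [hz, inner_add_left, inner_add_left, real_inner_smul_left, real_inner_smul_left,
        real_inner_smul_left, hp.inner_self h.mem_fst h.mem_snd h.ij,
        hp.inner_eq_gram h.mem_fst h.mem_trd h.mem_snd h.ik h.ij h.jk.symm,
        hp.inner_eq_gram h.mem_fst h.mem_fth h.mem_snd h.il h.ij h.jl.symm]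
      field_simp
      simp only [heightDet, areaSq, crossGram, gramDet, gram, ls k a, ls l a, ls l k]
      ring
    · rw [hz, inner_add_left, inner_add_left, real_inner_smul_left, real_inner_smul_left,
        real_inner_smul_left, hp.inner_self h.mem_fst h.mem_trd h.ik,
        hp.inner_eq_gram h.mem_fst h.mem_snd h.mem_trd h.ij h.ik h.jk,
        hp.inner_eq_gram h.mem_fst h.mem_fth h.mem_trd h.il h.ik h.kl.symm]
      field_simp
      simp only [heightDet, areaSq, crossGram, gramDet, gram, ls a j, ls l j, ls l a]
      ring
    · rw [hz, inner_add_left, inner_add_left, real_inner_smul_left, real_inner_smul_left,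
        real_inner_smul_left, hp.inner_self h.mem_fst h.mem_fth h.il,
        hp.inner_eq_gram h.mem_fst h.mem_snd h.mem_fth h.ij h.il h.jl,
        hp.inner_eq_gram h.mem_fst h.mem_trd h.mem_fth h.ik h.il h.kl]
      field_simp
      simp only [heightDet, areaSq, crossGram, gramDet, gram, ls k j, ls a j, ls a k]
      ring
  refine ⟨p i + z, fun a ha b hb hab => ?_⟩
  have hi := h.mem_fst
  by_cases hai : i = a
  · subst hai
    rw [add_sub_cancel_left, hzi b hb hab]
  have h1 := hzi a ha hai
  have h2 := hp.inner_self hi ha hai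
  have ea : p i + z - p a = z - (p a - p i) := by abel
  rw [ea]
  by_cases hbi : i = b
  · subst hbi
    rw [← neg_sub (p a) (p i), inner_neg_right, inner_sub_left, h1, h2]
    simp only [hx, hℓ, len]
    ring
  have h3 := hzi b hb hbi
  have h4 := hp.inner_eq_gram hi ha hb hai hbi hab
  -- For an edge missing `i`, compatibility with the conditions at `i` is exactly the equation on
  -- $d$ for the triangle `{i, a, b}`.
  have h5 := hd.2 i a b hai hab (Ne.symm hbi) (mem_of_subset_face hs
    (by simp [Finset.insert_subset_iff, hi, ha, hb]) (by simp))
  have eb : p b - p a = (p b - p i) - (p a - p i) := by abel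
  rw [eb, inner_sub_right, inner_sub_left z, inner_sub_left z, h1, h2, h3, h4]
  simp only [hx, hℓ, len, gram]
  linear_combination -h5 / 2

omit [Fintype V] in
lemma inner_center_sub {T : AbstractSimplicialComplex V} {d : DirEdge T → ℝ} (hd : d ∈ met T)
    {s : Finset V} (hs : s ∈ T) {i j k l : V} (h : IsTetrahedron s i j k l) {a b : V}
    (ha : a ∈ s) (hb : b ∈ s) (hab : a ≠ b) :
    inner ℝ (center d s - embed (len d) s a) (embed (len d) s b - embed (len d) s a) =
      dval d a b * len d a b := by
  have hp := isEmbedding_embed (hd.1 s hs)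
  obtain ⟨c, hc⟩ := exists_center hd hs hp h
  have hex : ∃ c : E3, ∀ a ∈ s, ∀ b ∈ s, a ≠ b →
      inner ℝ (c - AffineMap.lineMap (embed (len d) s a) (embed (len d) s b)
        (dval d a b / len d a b)) (embed (len d) s b - embed (len d) s a) = (0 : ℝ) :=
    ⟨c, fun a ha b hb hab =>
      (inner_sub_lineMap_eq_zero_iff hp ha hb hab c).2 (hc a ha b hb hab)⟩
  exact (inner_sub_lineMap_eq_zero_iff hp ha hb hab _).1
    (Classical.epsilon_spec hex a ha b hb hab)

/-- Let $n$ be the part of $p_l-p_i$ normal to the face and $y=c-p_i$. The height is $\langle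
n,y\rangle/|n|$ and the area $\sqrt Q/2$, while $Q|n|^2=D$ and $Q\langle n,y\rangle$ is `heightDet`.
-/
lemma centerHeight_mul_simplexVolume {T : AbstractSimplicialComplex V} {d : DirEdge T → ℝ}
    (hd : d ∈ met T) {s : Finset V} (hs : s ∈ T) {i j k l : V} (h : IsTetrahedron s i j k l) :
    centerHeight d s i l * simplexVolume (len d) (s.erase l) =
      heightDet (len d) (fun a => dval d i a * len d i a) i j k l /
        (2 * √(gramDet (len d) i j k l)) := by
  have hp := isEmbedding_embed (hd.1 s hs)
  have he : s.erase l = {i, j, k} := by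
    ext a
    simp only [h.eq, Finset.mem_erase, Finset.mem_insert, Finset.mem_singleton]
    have := h.il; have := h.jl; have := h.kl
    grind
  rw [he, simplexVolume_triangle (len_comm d) h.ij h.ik h.jk]
  simp only [centerHeight, he, signedDist_apply_apply, NormedSpace.normalize]
  set p := embed (len d) s with hpdef
  set S := vectorSpan ℝ (p '' (({i, j, k} : Finset V) : Set V)) with hS
  have hspan : S = Submodule.span ℝ {p j - p i, p k - p i} := by
    rw [hS, vectorSpan_eq_span_vsub_set_right ℝ (p := p i) (by simp)]
    simp [Set.image_insert_eq]
  have hj : p j - p i ∈ S := by rw [hspan]; exact Submodule.subset_span (by simp)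
  have hk : p k - p i ∈ S := by rw [hspan]; exact Submodule.subset_span (by simp)
  obtain ⟨β, γ, hβ⟩ := Submodule.mem_span_pair.1
    (hspan ▸ Submodule.starProjection_apply_mem S (p l - p i) :
      S.starProjection (p l - p i) ∈ Submodule.span ℝ {p j - p i, p k - p i})
  rw [Submodule.starProjection_orthogonal_val, ← hβ]
  have o₁ := Submodule.starProjection_inner_eq_zero (K := S) (p l - p i) _ hj
  have o₂ := Submodule.starProjection_inner_eq_zero (K := S) (p l - p i) _ hk
  rw [← hβ] at o₁ o₂
  obtain ⟨h1, h2⟩ := norm_sub_smul_sub_smul_of_orthogonal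
    (hp.inner_self h.mem_fst h.mem_snd h.ij)
    (hp.inner_eq_gram h.mem_fst h.mem_snd h.mem_trd h.ij h.ik h.jk)
    (hp.inner_self h.mem_fst h.mem_trd h.ik)
    (hp.inner_eq_gram h.mem_fst h.mem_snd h.mem_fth h.ij h.il h.jl)
    (hp.inner_eq_gram h.mem_fst h.mem_trd h.mem_fth h.ik h.il h.kl)
    (hp.inner_self h.mem_fst h.mem_fth h.il)
    (inner_center_sub hd hs h h.mem_fst h.mem_snd h.ij)
    (inner_center_sub hd hs h h.mem_fst h.mem_trd h.ik)
    (inner_center_sub hd hs h h.mem_fst h.mem_fth h.il) o₁ o₂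
  have hQ := hp.areaSq_pos h
  have hD := hp.gramDet_pos h
  set n := p l - p i - (β • (p j - p i) + γ • (p k - p i)) with hn
  set y := center d s - p i with hy
  have h1' : areaSq (len d) i j k * ‖n‖ ^ 2 = gramDet (len d) i j k l := h1
  have h2' : areaSq (len d) i j k * inner ℝ n y =
      heightDet (len d) (fun a => dval d i a * len d i a) i j k l := by
    refine h2.trans ?_
    simp only [heightDet, areaSq, crossGram, gram, len_comm d k j]
    ring
  have hn0 : 0 < ‖n‖ := by
    rw [norm_pos_iff]
    intro h0
    rw [h0] at h1'
    simp at h1'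
    exact hD.ne h1'
  rw [vsub_eq_sub, ← hy, real_inner_smul_left, ← h2', ← h1', Real.sqrt_mul hQ.le,
    Real.sqrt_sq hn0.le]
  have hq := Real.sqrt_pos.2 hQ
  have hq2 := Real.sq_sqrt hQ.le
  field_simp
  rw [hq2]

/-! ### Conformal variations -/

section conformal

variable {T : AbstractSimplicialComplex V} {L : ℝ → V → V → ℝ} {t : ℝ} {i : V}
  {d : DirEdge T → ℝ}

lemma hasDerivAt_simplexVolume_of_mem (hL : ∀ u a b, L u a b = L u b a) (hd : d ∈ met T)
    (hLd : L t = len d) (hi : ∀ j, Adj T i j → HasDerivAt (fun u => L u i j) (dval d i j) t)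
    (h0 : ∀ a b, a ≠ i → b ≠ i → HasDerivAt (fun u => L u a b) 0 t)
    {s : Finset V} (hs : s ∈ tetrahedra T) (his : i ∈ s) :
    HasDerivAt (fun u => simplexVolume (L u) s) ((1 / 3) * ∑ l ∈ s.erase i,
      centerHeight d s i l * simplexVolume (len d) (s.erase l)) t := by
  obtain ⟨hsT, hcard⟩ := mem_tetrahedra.1 hs
  obtain ⟨j, k, l, h⟩ := exists_isTetrahedron_of_mem hcard his
  obtain ⟨p, hp⟩ := hd.1 s hsT
  have hD := hp.gramDet_pos h
  have he : s.erase i = {j, k, l} := by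
    rw [h.eq, Finset.erase_insert]
    simp [h.ij, h.ik, h.il]
  rw [he, Finset.sum_insert (by simp [h.jk, h.jl]), Finset.sum_pair h.kl,
    centerHeight_mul_simplexVolume hd hsT h, centerHeight_mul_simplexVolume hd hsT h.swap_right,
    centerHeight_mul_simplexVolume hd hsT h.swap_mid.swap_right,
    gramDet_swap_mid (len_comm d) i l k j, gramDet_swap_right (len_comm d) i l j k,
    gramDet_swap_mid (len_comm d) i j l k, gramDet_swap_right (len_comm d) i j k l]
  have hg := hasDerivAt_gramDet hL
    (hi j (adj_of_mem hsT h.mem_fst h.mem_snd h.ij))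
    (hi k (adj_of_mem hsT h.mem_fst h.mem_trd h.ik))
    (hi l (adj_of_mem hsT h.mem_fst h.mem_fth h.il)) (h0 j k h.ij.symm h.ik.symm)
    (h0 j l h.ij.symm h.il.symm) (h0 k l h.ik.symm h.il.symm)
  rw [hLd] at hg
  simp only [simplexVolume_tetrahedron (hL _) h]
  have hsq := (hg.sqrt (by rw [hLd]; exact hD.ne')).div_const 6
  refine hsq.congr_deriv ?_
  rw [hLd]
  ring

lemma hasDerivAt_simplexVolume_of_notMem (hL : ∀ u a b, L u a b = L u b a) (hd : d ∈ met T)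
    (hLd : L t = len d) (h0 : ∀ a b, a ≠ i → b ≠ i → HasDerivAt (fun u => L u a b) 0 t)
    {s : Finset V} (hs : s ∈ tetrahedra T) (his : i ∉ s) :
    HasDerivAt (fun u => simplexVolume (L u) s) 0 t := by
  obtain ⟨hsT, hcard⟩ := mem_tetrahedra.1 hs
  obtain ⟨a, b, c, e, h⟩ := exists_isTetrahedron hcard
  obtain ⟨p, hp⟩ := hd.1 s hsT
  have hD := hp.gramDet_pos h
  have hne : ∀ x ∈ s, x ≠ i := fun x hx hxi => his (hxi ▸ hx)
  have h0' : ∀ x ∈ s, ∀ y ∈ s, HasDerivAt (fun u => L u x y) 0 t :=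
    fun x hx y hy => h0 x y (hne x hx) (hne y hy)
  have hg := hasDerivAt_gramDet (δ := 0) hL (h0' a h.mem_fst b h.mem_snd)
    (h0' a h.mem_fst c h.mem_trd) (h0' a h.mem_fst e h.mem_fth) (h0' b h.mem_snd c h.mem_trd)
    (h0' b h.mem_snd e h.mem_fth) (h0' c h.mem_trd e h.mem_fth)
  simp only [simplexVolume_tetrahedron (hL _) h]
  refine ((hg.sqrt (by rw [hLd]; exact hD.ne')).div_const 6).congr_deriv ?_
  simp [heightDet]

lemma hasDerivAt_totalVolume (hL : ∀ u a b, L u a b = L u b a) (hd : d ∈ met T)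
    (hLd : L t = len d) (hi : ∀ j, Adj T i j → HasDerivAt (fun u => L u i j) (dval d i j) t)
    (h0 : ∀ a b, a ≠ i → b ≠ i → HasDerivAt (fun u => L u a b) 0 t) :
    HasDerivAt (fun u => totalVolume T (L u)) (vertexVolume d i) t := by
  rw [vertexVolume, Finset.mul_sum, Finset.sum_filter]
  refine HasDerivAt.fun_sum fun s hs => ?_
  split_ifs with his
  · exact hasDerivAt_simplexVolume_of_mem hL hd hLd hi h0 hs his
  · exact hasDerivAt_simplexVolume_of_notMem hL hd hLd h0 hs his

open Classical in
lemma hasDerivAt_EHR_scalarCurvature (hL : ∀ u a b, L u a b = L u b a)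
    (hT : ∀ᶠ u in nhds t, IsPiecewiseFlat T (L u)) (hLd : L t = len d)
    (hi : ∀ j, HasDerivAt (fun u => L u i j) (dval d i j) t)
    (h0 : ∀ a b, a ≠ i → b ≠ i → HasDerivAt (fun u => L u a b) 0 t) :
    HasDerivAt (fun u => EHR T (L u)) (scalarCurvature d i) t := by
  have hi' : ∀ j, HasDerivAt (fun u => L u j i) (dval d i j) t := fun j => by
    simpa only [hL _ j i] using hi j
  have hdiff : ∀ a b, DifferentiableAt ℝ (fun u => L u a b) t := fun a b => by
    by_cases ha : a = i
    · subst ha; exact (hi b).differentiableAt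
    by_cases hb : b = i
    · subst hb; exact (hi' a).differentiableAt
    exact (h0 a b ha hb).differentiableAt
  refine (hasDerivAt_EHR hdiff hT hL).congr_deriv ?_
  -- An edge at `i` occurs in both orientations, which absorbs the factor 1/2 of Regge's formula;
  -- all other edges have derivative zero.
  have hsplit : ∀ q : V × V, (if Adj T q.1 q.2 then
      deficit T (L t) q.1 q.2 * deriv (fun u => L u q.1 q.2) t else 0) =
      (if q.1 = i then if Adj T i q.2 then deficit T (L t) i q.2 * dval d i q.2 else 0 else 0) +
      (if q.2 = i then if Adj T i q.1 then deficit T (L t) i q.1 * dval d i q.1 else 0 else 0) := by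
    rintro ⟨a, b⟩
    by_cases ha : a = i
    · subst ha
      by_cases hb : b = a
      · subst hb; simp [Adj]
      · simp [hb, (hi b).deriv]
    · by_cases hb : b = i
      · subst hb
        have hc : Adj T a b ↔ Adj T b a := ⟨Adj.symm, Adj.symm⟩
        simp [ha, (hi' a).deriv, hc, deficit_comm (hL t) hT.self_of_nhds (Ne.symm ha)]
      · simp [ha, hb, (h0 a b ha hb).deriv]
  rw [Finset.sum_filter, Finset.sum_congr rfl fun q _ => hsplit q, Finset.sum_add_distrib,
    Fintype.sum_prod_type, Fintype.sum_prod_type_right]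
  simp only [Finset.sum_ite_irrel, Finset.sum_const_zero, Finset.sum_ite_eq', Finset.mem_univ,
    if_true, ← Finset.sum_filter, hLd, scalarCurvature]
  ring

end conformal

/-! ### One-parameter length families from a conformal structure -/

omit [Fintype V] in
lemma len_eq_zero {T : AbstractSimplicialComplex V} {a b : V} (h : ¬ Adj T a b)
    (d : DirEdge T → ℝ) : len d a b = 0 := by
  simp only [len, dval]
  rw [dif_neg h, dif_neg fun h' => h h'.symm, add_zero]

section conformalStructure

variable {T : AbstractSimplicialComplex V} {U : Set (V → ℝ)} {C : (V → ℝ) → DirEdge T → ℝ}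

/-- For non-adjacent `i`, `j` both `len` and `dval` take the default value 0, so adjacency need not
be assumed. -/
lemma IsConformalStructure.hasDerivAt_len (hC : IsConformalStructure T U C) {f : V → ℝ}
    (hf : f ∈ U) (i j : V) :
    HasDerivAt (fun u => len (C (Function.update f i u)) i j) (dval (C f) i j) (f i) := by
  by_cases h : Adj T i j
  · exact hC.partial_len f hf i j h
  · have h0 : dval (C f) i j = 0 := dif_neg h
    simp only [len_eq_zero h, h0]
    exact hasDerivAt_const _ _

lemma IsConformalStructure.hasDerivAt_len_of_ne (hC : IsConformalStructure T U C) {f : V → ℝ}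
    (hf : f ∈ U) {i a b : V} (ha : a ≠ i) (hb : b ≠ i) :
    HasDerivAt (fun u => len (C (Function.update f i u)) a b) 0 (f i) := by
  by_cases h : Adj T a b
  · have := (hC.partial_d f hf a b h i ha.symm hb.symm).fun_add
      (hC.partial_d f hf b a h.symm i hb.symm ha.symm)
    rw [add_zero] at this
    exact this
  · simp only [len_eq_zero h]
    exact hasDerivAt_const _ _

/-- The closed formula for dihedral angles needs an actual embedding, and differentiating it needs
one at all nearby parameters; openness of `U` supplies them. -/
lemma IsConformalStructure.eventually_isPiecewiseFlat (hC : IsConformalStructure T U C)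
    {f : V → ℝ} (hf : f ∈ U) (i : V) :
    ∀ᶠ u in nhds (f i), IsPiecewiseFlat T (len (C (Function.update f i u))) := by
  have hcont : ContinuousAt (fun u => Function.update f i u) (f i) := by fun_prop
  have hmem : U ∈ nhds (Function.update f i (f i)) := by
    rw [Function.update_eq_self]; exact hC.isOpen.mem_nhds hf
  filter_upwards [hcont.preimage_mem_nhds hmem] with u hu
  exact (hC.mapsTo hu).1

end conformalStructure

end PiecewiseFlat

end

theorem mainTheorem11 {V M : Type*} [Fintype V] [DecidableEq V]
    [TopologicalSpace M] [T2Space M] [CompactSpace M] [ChartedSpace (EuclideanSpace ℝ (Fin 3)) M]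
    (T : AbstractSimplicialComplex V)
    (φ : PiecewiseFlat.geometricRealization T ≃ₜ M)
    (U : Set (V → ℝ)) (C : (V → ℝ) → PiecewiseFlat.DirEdge T → ℝ)
    (hC : PiecewiseFlat.IsConformalStructure T U C) :
    ∀ f ∈ U, ∀ i : V,
      PiecewiseFlat.HasPartialDerivAt
        (fun g => PiecewiseFlat.EHR T (PiecewiseFlat.len (C g))) i
        (PiecewiseFlat.scalarCurvature (C f) i) f ∧
      PiecewiseFlat.HasPartialDerivAt
        (fun g => PiecewiseFlat.totalVolume T (PiecewiseFlat.len (C g))) i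
        (PiecewiseFlat.vertexVolume (C f) i) f := by
  intro f hf i
  have hL : ∀ u a b, PiecewiseFlat.len (C (Function.update f i u)) a b =
      PiecewiseFlat.len (C (Function.update f i u)) b a := fun u => PiecewiseFlat.len_comm _
  have hLd : PiecewiseFlat.len (C (Function.update f i (f i))) = PiecewiseFlat.len (C f) := by
    rw [Function.update_eq_self]
  exact ⟨PiecewiseFlat.hasDerivAt_EHR_scalarCurvature hL (hC.eventually_isPiecewiseFlat hf i) hLd
      (hC.hasDerivAt_len hf i) fun a b ha hb => hC.hasDerivAt_len_of_ne hf ha hb,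
    PiecewiseFlat.hasDerivAt_totalVolume hL (hC.mapsTo hf) hLd
      (fun j _ => hC.hasDerivAt_len hf i j) fun a b ha hb => hC.hasDerivAt_len_of_ne hf ha hb⟩
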